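/- Let $\mathbb N=\{1,2,\dots\}$. For a probability measure $\mu$ on $\{0,1\}^{\mathbb N}$ (with the $\sigma$-algebra generated by the cylinders) let $p(j)=\mathbb E_{X\sim\mu}[X(j)]$, let $\hat p_n=\frac1n\sum_{i=1}^n X_i$ be the empirical mean of $n$ independent draws $X_1,\dots,X_n\sim\mu$, and put $$\Delta_n(\mu)=\mathbb E\,\sup_{j\in\mathbb N}|\hat p_n(j)-p(j)|.$$ For $p\in[0,1]^{\mathbb N}$ let $\Delta_n(p)=\Delta_n(\mu)$, where $\mu$ is the product measure on $\{0,1\}^{\mathbb N}$ with mean $p$. Let $\mathsf{LGC}$ be the set of all non-increasing sequences $p\in[0,\frac12]^{\mathbb N}$ with $p(j)\to0$ for which $\Delta_n(p)\to0$ as $n\to\infty$. For a non-increasing sequence $p\in[0,\frac12]^{\mathbb N}$ with $p(j)\to0$ define $$S(p)=\sup_{j\in\mathbb N}p(j)\log(j+1),\qquad T(p)=\sup_{j\in\mathbb N}\frac{\log(j+1)}{\log(1/p(j))},$$ where a term of $T(p)$ with $p(j)=0$ is read as $0$. For a probability measure $\mu$ on $\{0,1\}^{\mathbb N}$ with mean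 $p$ let $\tilde p(j)=\min\{p(j),1-p(j)\}$. If $\tilde p(j)\to0$, let $\tilde p^{\downarrow}$ be the decreasing rearrangement of $\tilde p$, that is, $\tilde p^{\downarrow}(j)=\min\{t\ge0:\ |\{i:\tilde p(i)>t\}|\le j-1\}$, and let $S(\mu)=S(\tilde p^{\downarrow})$, $T(\mu)=T(\tilde p^{\downarrow})$; otherwise let $S(\mu)=T(\mu)=\infty$. **Theorem (Coarse asymptotics of $\Delta_n$).** There are absolute constants $c,c'>0$ such that the following holds. For every product probability measure $\mu$ on $\{0,1\}^{\mathbb N}$ whose mean $p$ belongs to $\mathsf{LGC}$, $$c\sqrt{S(p)}\le\liminf_{n\to\infty}\sqrt n\,\Delta_n(p)\le\limsup_{n\to\infty}\sqrt n\,\Delta_n(p)\le c'\sqrt{S(p)}.$$ Moreover, for every (not necessarily product) probability measure $\mu$ on $\{0,1\}^{\mathbb N}$ with $T(\mu)<\infty$, $$\limsup_{n\to\infty}\sqrt n\,\Delta_n(\mu)\le c'\sqrt{S(\mu)}.$$ -/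

import Mathlib

open MeasureTheory ProbabilityTheory Filter Topology
open scoped ENNReal NNReal

noncomputable section

namespace LocalGC

/- Coordinates are indexed by `ℕ = {0, 1, 2, …}`: index `j` here stands for the coordinate
`j + 1` when coordinates are numbered from `1`. -/

/-- The cube `{0,1}^ℕ`, with the product sigma-algebra (generated by the cylinders). -/
abbrev Cube : Type := ℕ → Bool

/-- The bit `0` or `1`, as a real number. -/
def bit (b : Bool) : ℝ := if b then 1 else 0

/-- The mean `p(j) = E X(j)`, `X ∼ μ`. -/
def mean (μ : Measure Cube) (j : ℕ) : ℝ := ∫ x, bit (x j) ∂μ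

/-- The empirical mean `p̂ₙ(j) = n⁻¹ ∑ᵢ Xᵢ(j)` of a sample `X₁, …, Xₙ`. -/
def empMean {n : ℕ} (X : Fin n → Cube) (j : ℕ) : ℝ := (n : ℝ)⁻¹ * ∑ i, bit (X i j)

/-- The expected maximal deviation `Δₙ(μ) = E sup_j |p̂ₙ(j) - p(j)|`, the sample being
`n` iid draws from `μ`. -/
def Δ (n : ℕ) (μ : Measure Cube) : ℝ≥0∞ :=
  ∫⁻ X : Fin n → Cube, ⨆ j : ℕ, ENNReal.ofReal |empMean X j - mean μ j|
    ∂(Measure.pi fun _ : Fin n => μ)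

/-- `μ` is a tensor product of probability measures on `{0,1}`. -/
def IsProduct (μ : Measure Cube) : Prop :=
  ∃ ν : ℕ → Measure Bool, (∀ j, IsProbabilityMeasure (ν j)) ∧ μ = Measure.infinitePi ν

/-- The product of the measures `Bernoulli(p(j))`, for `p ∈ [0,1]^ℕ`
(values outside `[0,1]` are projected to `[0,1]`). -/
def bernoulliProduct (p : ℕ → ℝ) : Measure Cube :=
  Measure.infinitePi fun j =>
    bernoulliMeasure true false (Set.projIcc (0 : ℝ) 1 zero_le_one (p j))

/-- The set of all `p ∈ [0,1/2]^ℕ` that decrease (weakly) to `0`. -/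
def decreasingToZero : Set (ℕ → ℝ) :=
  {p | (∀ j, p j ∈ Set.Icc (0 : ℝ) (1 / 2)) ∧ Antitone p ∧ Tendsto p atTop (𝓝 0)}

/-- The local Glivenko-Cantelli sequences: those `p ∈ [0,1/2]^ℕ` decreasing to `0` for which
`Δₙ(p) → 0`, where `Δₙ(p)` is `Δₙ` of the product measure with mean `p`. -/
def LGC : Set (ℕ → ℝ) :=
  {p | p ∈ decreasingToZero ∧ Tendsto (fun n => Δ n (bernoulliProduct p)) atTop (𝓝 0)}

/-- `S(p) = sup_{j ≥ 1} p(j) log (j + 1)`. -/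
def S (p : ℕ → ℝ) : ℝ≥0∞ := ⨆ j : ℕ, ENNReal.ofReal (p j * Real.log ((j + 1 : ℝ) + 1))

/-- `T(p) = sup_{j ≥ 1} log (j + 1) / log (1 / p(j))`; a term with `p(j) = 0` is `0`,
since there `log (1 / p(j)) = ∞`. -/
def T (p : ℕ → ℝ) : ℝ≥0∞ :=
  ⨆ j : ℕ, if p j = 0 then 0
    else ENNReal.ofReal (Real.log ((j + 1 : ℝ) + 1) / Real.log (1 / p j))

/-- `p̃(j) = min {p(j), 1 - p(j)}`. -/
def fold (p : ℕ → ℝ) (j : ℕ) : ℝ := min (p j) (1 - p j)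

/-- The decreasing rearrangement `q↓` of a nonnegative sequence `q` tending to `0`: the entry
with index `j` is the least `t ≥ 0` that at most `j` entries of `q` exceed. -/
def rearr (q : ℕ → ℝ) (j : ℕ) : ℝ := sInf {t : ℝ | 0 ≤ t ∧ {i | t < q i}.encard ≤ j}

open Classical in
/-- `S(μ) = S(p̃↓)` if `p̃(j) → 0`, and `∞` otherwise, where `p` is the mean of `μ`. -/
def measS (μ : Measure Cube) : ℝ≥0∞ :=
  if Tendsto (fold (mean μ)) atTop (𝓝 0) then S (rearr (fold (mean μ))) else ⊤

open Classical in
/-- `T(μ) = T(p̃↓)` if `p̃(j) → 0`, and `∞` otherwise, where `p` is the mean of `μ`. -/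
def measT (μ : Measure Cube) : ℝ≥0∞ :=
  if Tendsto (fold (mean μ)) atTop (𝓝 0) then T (rearr (fold (mean μ))) else ⊤

end LocalGC

end

noncomputable section

namespace LocalGC

/-! ### Exponential moments of the deviations -/

/-! Upper bound. For a threshold `s` of order `√S`, `√n Δₙ` is at most `s` plus the sum over `j` of
the expected excesses of `√n |p̂ₙ(j) - p(j)|` over `s` (`sqrt_mul_Δ_le`), so no independence between
coordinates is needed. A Chernoff bound (`excess_le`) controls each excess, and the coordinate of
rank `j` in the rearrangement of `p̃` is treated in one of two regimes. If its mean is not too small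
compared with `s / √n`, the deviation is sub-Gaussian and `p̃↓(j) ≤ S₀ / log (j + 2)` gives at most
`s / (j + 2)²` (`excess_le_of_moderate`). Otherwise the tail is Poissonian, and the polynomial decay
of `p̃↓` given by `T < ∞` yields a vanishing multiple of `1 / (j + 2)²` (`excess_le_of_rare`). Both
are summable.

Lower bound. In a product measure the columns of the sample are independent. If each of the first
`N` deviates by `t` with probability of order `1 / N`, then some column does so with probability
bounded below (`ofReal_le_Δ_of_columns`). For fixed `j` the central limit theorem provides this for
the first `j + 1` columns, with `√n t` of order `√(p(j) log (j + 2))`. The same principle, applied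
to the event that a column consists of ones, shows that `T(p) < ∞` on `LGC` (`T_mean_lt_top`), so
the upper bound applies there. -/

lemma measurable_bit : Measurable bit := measurable_of_countable _

lemma bit_nonneg (b : Bool) : 0 ≤ bit b := by cases b <;> simp [bit]

lemma bit_le_one (b : Bool) : bit b ≤ 1 := by cases b <;> simp [bit]

lemma measurable_empMean {n : ℕ} (j : ℕ) :
    Measurable fun X : Fin n → Cube => empMean X j := by
  unfold empMean
  refine Measurable.const_mul (Finset.measurable_fun_sum _ fun i _ => ?_) _
  exact measurable_bit.comp (by fun_prop)

lemma integrable_bit (μ : Measure Cube) [IsProbabilityMeasure μ] (j : ℕ) :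
    Integrable (fun x : Cube => bit (x j)) μ := by
  refine Integrable.of_bound (C := 1) ?_ (ae_of_all _ fun x => ?_)
  · exact (measurable_bit.comp (measurable_pi_apply j)).aestronglyMeasurable
  · rw [Real.norm_of_nonneg (bit_nonneg _)]; exact bit_le_one _

lemma mean_mem_Icc (μ : Measure Cube) [IsProbabilityMeasure μ] (j : ℕ) :
    mean μ j ∈ Set.Icc (0 : ℝ) 1 := by
  refine ⟨integral_nonneg fun x => bit_nonneg _, ?_⟩
  calc mean μ j ≤ ∫ _ : Cube, (1 : ℝ) ∂μ :=
        integral_mono (integrable_bit μ j) (integrable_const _) fun x => bit_le_one _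
    _ = 1 := by simp

lemma integral_comp_apply (μ : Measure Cube) [IsProbabilityMeasure μ] (j : ℕ) (f : Bool → ℝ) :
    ∫ x, f (x j) ∂μ = mean μ j * f true + (1 - mean μ j) * f false := by
  have h : ∀ x : Cube, f (x j) = f false + (f true - f false) * bit (x j) := by
    intro x; cases x j <;> simp [bit]
  simp_rw [h]
  rw [integral_add (integrable_const _) ((integrable_bit μ j).const_mul _), integral_const_mul]
  simp only [integral_const, probReal_univ, one_smul]
  rw [← mean]; ring

lemma exp_neg_sub_one_add_le {t : ℝ} (ht : 0 ≤ t) :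
    Real.exp (-t) - 1 + t ≤ Real.exp t - 1 - t := by
  have h := Real.self_le_sinh_iff.2 ht
  rw [Real.sinh_eq] at h
  linarith

lemma exp_sub_one_sub_le_abs (t : ℝ) :
    Real.exp t - 1 - t ≤ Real.exp |t| - 1 - |t| := by
  rcases le_total 0 t with h | h
  · rw [abs_of_nonneg h]
  · rw [abs_of_nonpos h]
    have := exp_neg_sub_one_add_le (neg_nonneg.2 h)
    rw [neg_neg] at this
    linarith

/-- Factor out `exp (-θp)` and use `1 + x ≤ exp x`. This is a Bennett-type bound, good both for
small and for large `θ`. -/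
lemma bernoulli_mgf_le_left {p : ℝ} (hp : 0 ≤ p) (θ : ℝ) :
    p * Real.exp (θ * (1 - p)) + (1 - p) * Real.exp (θ * (0 - p)) ≤
      Real.exp (p * (Real.exp |θ| - 1 - |θ|)) := by
  have h1 : Real.exp (θ * (1 - p)) = Real.exp θ * Real.exp (-(θ * p)) := by
    rw [← Real.exp_add]; ring_nf
  have h2 : Real.exp (θ * (0 - p)) = Real.exp (-(θ * p)) := by ring_nf
  calc p * Real.exp (θ * (1 - p)) + (1 - p) * Real.exp (θ * (0 - p))
      = Real.exp (-(θ * p)) * (p * (Real.exp θ - 1) + 1) := by rw [h1, h2]; ring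
    _ ≤ Real.exp (-(θ * p)) * Real.exp (p * (Real.exp θ - 1)) := by
        gcongr; exact Real.add_one_le_exp _
    _ = Real.exp (p * (Real.exp θ - 1 - θ)) := by rw [← Real.exp_add]; ring_nf
    _ ≤ _ := by
        exact Real.exp_le_exp.2 (mul_le_mul_of_nonneg_left (exp_sub_one_sub_le_abs θ) hp)

lemma bernoulli_mgf_le {p : ℝ} (hp : p ∈ Set.Icc (0 : ℝ) 1) (θ : ℝ) :
    p * Real.exp (θ * (1 - p)) + (1 - p) * Real.exp (θ * (0 - p)) ≤
      Real.exp (min p (1 - p) * (Real.exp |θ| - 1 - |θ|)) := by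
  rcases min_choice p (1 - p) with h | h <;> rw [h]
  · exact bernoulli_mgf_le_left hp.1 θ
  -- Exchanging the two values of the bit turns `(p, θ)` into `(1 - p, -θ)`.
  · have := bernoulli_mgf_le_left (p := 1 - p) (by linarith [hp.2]) (-θ)
    rw [abs_neg] at this
    refine le_trans (le_of_eq ?_) this
    ring_nf

lemma lintegral_exp_deviation_le (μ : Measure Cube) [IsProbabilityMeasure μ] {n : ℕ} (hn : 0 < n)
    (j : ℕ) (θ : ℝ) :
    ∫⁻ X : Fin n → Cube, ENNReal.ofReal (Real.exp (θ * n * (empMean X j - mean μ j)))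
        ∂(Measure.pi fun _ : Fin n => μ) ≤
      ENNReal.ofReal (Real.exp (n * (fold (mean μ) j * (Real.exp |θ| - 1 - |θ|)))) := by
  have hn' : (n : ℝ) ≠ 0 := by positivity
  have hprod : ∀ X : Fin n → Cube, Real.exp (θ * n * (empMean X j - mean μ j)) =
      ∏ i, Real.exp (θ * (bit (X i j) - mean μ j)) := by
    intro X
    rw [← Real.exp_sum, ← Finset.mul_sum, Finset.sum_sub_distrib]
    simp only [empMean, Finset.sum_const, Finset.card_univ, Fintype.card_fin, nsmul_eq_mul]
    congr 1
    field_simp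
  have hint : Integrable (fun X : Fin n → Cube =>
      ∏ i, Real.exp (θ * (bit (X i j) - mean μ j))) (Measure.pi fun _ : Fin n => μ) := by
    refine Integrable.fintype_prod (f := fun _ : Fin n => fun x : Cube =>
      Real.exp (θ * (bit (x j) - mean μ j))) fun _ => ?_
    refine Integrable.of_bound (C := Real.exp |θ|) ?_ (ae_of_all _ fun x => ?_)
    · exact (Real.measurable_exp.comp (((measurable_bit.comp
        (measurable_pi_apply j)).sub_const _).const_mul θ)).aestronglyMeasurable
    · rw [Real.norm_of_nonneg (Real.exp_nonneg _), Real.exp_le_exp]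
      refine (le_abs_self _).trans ?_
      rw [abs_mul]
      refine mul_le_of_le_one_right (abs_nonneg _) ?_
      have h1 := mean_mem_Icc μ j
      rw [abs_le]
      constructor <;> linarith [bit_nonneg (x j), bit_le_one (x j), h1.1, h1.2]
  simp_rw [hprod]
  rw [← ofReal_integral_eq_lintegral_ofReal hint
    (ae_of_all _ fun X => Finset.prod_nonneg fun i _ => Real.exp_nonneg _)]
  refine ENNReal.ofReal_le_ofReal ?_
  rw [integral_fintype_prod_eq_pow (f := fun x : Cube => Real.exp (θ * (bit (x j) - mean μ j))),
    Fintype.card_fin, Real.exp_nat_mul]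
  refine pow_le_pow_left₀ (integral_nonneg fun x => Real.exp_nonneg _) ?_ n
  rw [integral_comp_apply μ j fun b => Real.exp (θ * (bit b - mean μ j))]
  simpa [bit, fold] using bernoulli_mgf_le (mean_mem_Icc μ j) θ

/-- The expected excess of `√n |p̂ₙ(j) - p(j)|` over a threshold. -/
def excess (n : ℕ) (μ : Measure Cube) (s : ℝ) (j : ℕ) : ℝ≥0∞ :=
  ∫⁻ X : Fin n → Cube, ENNReal.ofReal (√n * |empMean X j - mean μ j| - s)
    ∂(Measure.pi fun _ : Fin n => μ)

/-- Chernoff bound for an expectation: `y ≤ exp (λ y) / λ` with `λ = θ √n`. The factor `2` accounts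
for the two signs of the deviation. -/
lemma excess_le (μ : Measure Cube) [IsProbabilityMeasure μ] {n : ℕ} (hn : 0 < n) (s : ℝ) (j : ℕ)
    {θ r : ℝ} (hθ : 0 < θ) (hr : fold (mean μ) j ≤ r) :
    excess n μ s j ≤ ENNReal.ofReal
      (2 / (θ * √n) * Real.exp (n * (r * (Real.exp θ - 1 - θ)) - θ * √n * s)) := by
  have hn' : (0 : ℝ) < n := by positivity
  have hsq : √(n : ℝ) * √n = n := Real.mul_self_sqrt hn'.le
  have hsn : 0 < √(n : ℝ) := Real.sqrt_pos.2 hn'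
  have hφ : 0 ≤ Real.exp θ - 1 - θ := by linarith [Real.add_one_le_exp θ]
  set C : ℝ := 1 / (θ * √n) * Real.exp (-(θ * √n * s)) with hC
  have hC0 : 0 ≤ C := by positivity
  have hpt : ∀ X : Fin n → Cube, ENNReal.ofReal (√n * |empMean X j - mean μ j| - s) ≤
      ENNReal.ofReal C * (ENNReal.ofReal (Real.exp (θ * n * (empMean X j - mean μ j))) +
        ENNReal.ofReal (Real.exp (-θ * n * (empMean X j - mean μ j)))) := by
    intro X
    rw [← ENNReal.ofReal_add (Real.exp_nonneg _) (Real.exp_nonneg _), ← ENNReal.ofReal_mul hC0]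
    refine ENNReal.ofReal_le_ofReal ?_
    set d := empMean X j - mean μ j
    have h1 : Real.exp (θ * n * |d|) ≤ Real.exp (θ * n * d) + Real.exp (-θ * n * d) := by
      rcases abs_choice d with h | h <;> rw [h]
      · linarith [Real.exp_nonneg (-θ * n * d)]
      · rw [show θ * n * -d = -θ * n * d by ring]
        linarith [Real.exp_nonneg (θ * n * d)]
    have h2 : √n * |d| - s ≤
        1 / (θ * √n) * Real.exp (θ * √n * (√n * |d| - s)) := by
      rw [one_div, ← div_eq_inv_mul, le_div_iff₀ (by positivity)]
      linarith [Real.add_one_le_exp (θ * √n * (√n * |d| - s))]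
    refine h2.trans ?_
    have h3 : Real.exp (θ * √n * (√n * |d| - s)) =
        Real.exp (-(θ * √n * s)) * Real.exp (θ * n * |d|) := by
      rw [← Real.exp_add]
      congr 1
      linear_combination (θ * |d|) * hsq
    rw [h3, ← mul_assoc, hC]
    gcongr
  have hmeas : ∀ t : ℝ, Measurable fun X : Fin n → Cube =>
      ENNReal.ofReal (Real.exp (t * n * (empMean X j - mean μ j))) := fun t =>
    ENNReal.measurable_ofReal.comp (Real.measurable_exp.comp
      (((measurable_empMean j).sub_const _).const_mul _))
  have hmgf : ∀ t : ℝ, |t| = θ → ∫⁻ X : Fin n → Cube,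
      ENNReal.ofReal (Real.exp (t * n * (empMean X j - mean μ j)))
        ∂(Measure.pi fun _ : Fin n => μ) ≤
      ENNReal.ofReal (Real.exp (n * (r * (Real.exp θ - 1 - θ)))) := by
    intro t ht
    refine (lintegral_exp_deviation_le μ hn j t).trans ?_
    rw [ht]
    gcongr
  calc excess n μ s j ≤ _ := lintegral_mono hpt
    _ = ENNReal.ofReal C * (_ + _) := by
        rw [lintegral_const_mul' _ _ ENNReal.ofReal_ne_top, lintegral_add_left (hmeas _)]
    _ ≤ ENNReal.ofReal C * (ENNReal.ofReal (Real.exp (n * (r * (Real.exp θ - 1 - θ)))) +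
          ENNReal.ofReal (Real.exp (n * (r * (Real.exp θ - 1 - θ))))) := by
        gcongr
        · exact hmgf θ (abs_of_pos hθ)
        · exact hmgf (-θ) (by rw [abs_neg, abs_of_pos hθ])
    _ = _ := by
        rw [← ENNReal.ofReal_add (Real.exp_nonneg _) (Real.exp_nonneg _), ← ENNReal.ofReal_mul hC0,
          sub_eq_add_neg (_ * _), Real.exp_add, hC]
        congr 1
        ring

/-- With `r = 0` the exponent in `excess_le` is nonpositive for all `θ > 0`, and the prefactor
vanishes as `θ → ∞`. -/
lemma excess_eq_zero (μ : Measure Cube) [IsProbabilityMeasure μ] {n : ℕ} (hn : 0 < n) {s : ℝ}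
    (hs : 0 < s) (j : ℕ) (h0 : fold (mean μ) j ≤ 0) : excess n μ s j = 0 := by
  have hsn : 0 < √(n : ℝ) := Real.sqrt_pos.2 (by positivity)
  have h1 : ∀ᶠ θ : ℝ in atTop, excess n μ s j ≤ ENNReal.ofReal (2 / √n * θ⁻¹) := by
    filter_upwards [eventually_gt_atTop 0] with θ hθ
    refine (excess_le μ hn s j hθ h0).trans (ENNReal.ofReal_le_ofReal ?_)
    have h2 : Real.exp (n * (0 * (Real.exp θ - 1 - θ)) - θ * √n * s) ≤ 1 := by
      rw [Real.exp_le_one_iff, zero_mul, mul_zero, zero_sub, neg_nonpos]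
      positivity
    calc _ ≤ 2 / (θ * √n) * 1 := by gcongr
      _ = _ := by field_simp
  have h2 : Tendsto (fun θ : ℝ => ENNReal.ofReal (2 / √n * θ⁻¹)) atTop (𝓝 0) := by
    have := ENNReal.tendsto_ofReal (tendsto_inv_atTop_zero.const_mul (2 / √(n : ℝ)))
    simpa using this
  exact le_antisymm (ge_of_tendsto h2 h1) bot_le

lemma sqrt_mul_Δ_le (μ : Measure Cube) [IsProbabilityMeasure μ] (n : ℕ) (s : ℝ) :
    ENNReal.ofReal √n * Δ n μ ≤ ENNReal.ofReal s + ∑' j, excess n μ s j := by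
  have hmeas : ∀ j, Measurable fun X : Fin n → Cube =>
      ENNReal.ofReal (√n * |empMean X j - mean μ j| - s) := fun j =>
    ENNReal.measurable_ofReal.comp
      ((((measurable_empMean j).sub_const _).abs.const_mul _).sub_const _)
  have hmeas' : Measurable fun X : Fin n → Cube =>
      ⨆ j, ENNReal.ofReal |empMean X j - mean μ j| :=
    Measurable.iSup fun j => ENNReal.measurable_ofReal.comp
      ((measurable_empMean j).sub_const _).abs
  calc ENNReal.ofReal √n * Δ n μ
      = ∫⁻ X : Fin n → Cube, ENNReal.ofReal √n * ⨆ j, ENNReal.ofReal |empMean X j - mean μ j|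
          ∂(Measure.pi fun _ : Fin n => μ) := by
        rw [Δ, lintegral_const_mul _ hmeas']
    _ ≤ ∫⁻ X : Fin n → Cube, (ENNReal.ofReal s +
          ∑' j, ENNReal.ofReal (√n * |empMean X j - mean μ j| - s))
          ∂(Measure.pi fun _ : Fin n => μ) := by
        refine lintegral_mono fun X => ?_
        simp only
        rw [ENNReal.mul_iSup]
        refine iSup_le fun j => ?_
        rw [← ENNReal.ofReal_mul (Real.sqrt_nonneg _)]
        calc ENNReal.ofReal (√n * |empMean X j - mean μ j|)
            = ENNReal.ofReal (s + (√n * |empMean X j - mean μ j| - s)) := by ring_nf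
          _ ≤ _ := ENNReal.ofReal_add_le
          _ ≤ _ := by gcongr; exact ENNReal.le_tsum j
    _ = _ := by
        rw [lintegral_add_left measurable_const, lintegral_tsum fun j => (hmeas j).aemeasurable]
        simp [excess]

/-! ### The decreasing rearrangement -/

/-- `σ i` is the rank of `i`: the number of entries above `q i`, ties being broken by the index. It
is finite because `q → 0 < q i`. For `t < q i`, the entry `i` and the `σ i` entries ranked before it
all exceed `t`. -/
lemma exists_injective_le_rearr {q : ℕ → ℝ} (hq : Tendsto q atTop (𝓝 0)) :
    ∃ σ : {i // 0 < q i} → ℕ, Function.Injective σ ∧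
      ∀ i : {i // 0 < q i}, q i ≤ rearr q (σ i) := by
  set R : ℕ → Set ℕ := fun i => {k | q i < q k ∨ (q k = q i ∧ k < i)} with hR
  have hfin : ∀ i, 0 < q i → (R i).Finite := by
    intro i hi
    have h1 : ∀ᶠ k in cofinite, q k < q i := by
      rw [Nat.cofinite_eq_atTop]; exact hq.eventually_lt_const hi
    refine (eventually_cofinite.1 h1).subset fun k hk => ?_
    rcases hk with h | h
    · exact not_lt.2 h.le
    · exact not_lt.2 h.1.ge
  have hmono : ∀ i k, 0 < q i → 0 < q k → i ∈ R k → (R i).ncard < (R k).ncard := by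
    intro i k _ hk hik
    refine Set.ncard_lt_ncard ⟨fun l hl => ?_, fun h => ?_⟩ (hfin k hk)
    · rcases hik with h | h <;> rcases hl with h' | h'
      · exact Or.inl (h.trans h')
      · exact Or.inl (h'.1 ▸ h)
      · exact Or.inl (h.1 ▸ h')
      · exact Or.inr ⟨h'.1.trans h.1, h'.2.trans h.2⟩
    · rcases h hik with h | h
      · exact lt_irrefl _ h
      · exact lt_irrefl _ h.2
  refine ⟨fun i => (R i).ncard, ?_, ?_⟩
  · rintro ⟨i, hi⟩ ⟨k, hk⟩ h
    by_contra hne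
    have hne' : i ≠ k := fun h => hne (Subtype.ext h)
    rcases lt_trichotomy (q i) (q k) with h' | h' | h'
    · exact (hmono k i hk hi (Or.inl h')).ne' h
    · rcases lt_or_gt_of_ne hne' with h'' | h''
      · exact (hmono i k hi hk (Or.inr ⟨h', h''⟩)).ne h
      · exact (hmono k i hk hi (Or.inr ⟨h'.symm, h''⟩)).ne' h
    · exact (hmono i k hi hk (Or.inl h')).ne h
  · rintro ⟨i, hi⟩
    refine le_csInf ⟨q i, hi.le, ?_⟩ ?_
    · rw [(hfin i hi).cast_ncard_eq]
      exact Set.encard_le_encard fun k hk => Or.inl hk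
    · rintro t ⟨_, ht⟩
      by_contra! hlt
      have hi' : i ∉ R i := by
        rintro (h | h)
        · exact lt_irrefl _ h
        · exact lt_irrefl _ h.2
      have hsub : insert i (R i) ⊆ {k | t < q k} := by
        rintro k (rfl | h | h)
        · exact hlt
        · exact hlt.trans h
        · exact hlt.trans_eq h.1.symm
      have h1 := (Set.encard_le_encard hsub).trans ht
      rw [← ((hfin i hi).insert i).cast_ncard_eq, Set.ncard_insert_of_notMem hi' (hfin i hi)] at h1
      exact absurd (Nat.cast_le.1 h1) (Nat.not_succ_le_self _)

lemma rearr_nonneg (q : ℕ → ℝ) (j : ℕ) : 0 ≤ rearr q j := Real.sInf_nonneg fun _ h => h.1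

lemma rearr_le_of_le {q : ℕ → ℝ} {b : ℝ} (hb : 0 ≤ b) (h : ∀ i, q i ≤ b) (j : ℕ) :
    rearr q j ≤ b := by
  refine csInf_le ⟨0, fun _ h => h.1⟩ ⟨hb, ?_⟩
  rw [show {i | b < q i} = ∅ from Set.eq_empty_of_forall_notMem fun i hi => (h i).not_gt hi]
  simp

lemma rearr_of_antitone {q : ℕ → ℝ} (h0 : ∀ i, 0 ≤ q i) (hq : Antitone q) : rearr q = q := by
  funext j
  have hmem : ∀ t, {i | t < q i}.encard ≤ j ↔ q j ≤ t := by
    intro t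
    constructor
    · intro h
      by_contra! hlt
      have hsub : (Finset.range (j + 1) : Set ℕ) ⊆ {i | t < q i} := fun i hi =>
        hlt.trans_le (hq (by simpa [Nat.lt_succ_iff] using hi))
      have h1 := (Set.encard_le_encard hsub).trans h
      rw [Set.encard_coe_eq_coe_finsetCard, Finset.card_range] at h1
      norm_cast at h1
      omega
    · intro h
      have hsub : {i | t < q i} ⊆ (Finset.range j : Set ℕ) := by
        intro i hi
        by_contra hij
        have : j ≤ i := by simpa using hij
        exact absurd (hi.trans_le ((hq this).trans h)) (lt_irrefl _)
      refine (Set.encard_le_encard hsub).trans ?_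
      rw [Set.encard_coe_eq_coe_finsetCard, Finset.card_range]
  have hset : {t : ℝ | 0 ≤ t ∧ {i | t < q i}.encard ≤ j} = Set.Ici (q j) := by
    ext t
    simp only [Set.mem_ofPred_eq, hmem, Set.mem_Ici]
    exact ⟨fun h => h.2, fun h => ⟨(h0 j).trans h, h⟩⟩
  rw [rearr, hset, csInf_Ici]

/-! ### The upper bound -/

lemma half_le_log (j : ℕ) : 1 / 2 ≤ Real.log ((j + 1 : ℝ) + 1) := by
  have h : Real.log 2 ≤ Real.log ((j + 1 : ℝ) + 1) := by
    apply Real.log_le_log (by norm_num)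
    have : (0 : ℝ) ≤ j := by positivity
    linarith
  linarith [Real.log_two_gt_d9]

/-- Sub-Gaussian regime: the chosen `θ` is at most `1`, so `exp θ - 1 - θ ≤ θ ^ 2`. -/
lemma excess_le_of_moderate (μ : Measure Cube) [IsProbabilityMeasure μ] {n : ℕ} (hn : 0 < n)
    {s r S₀ : ℝ} {i j : ℕ} (hs : 0 < s) (hr : 0 < r) (hsS : s ^ 2 = 32 * S₀)
    (hrS : r ≤ S₀ / Real.log ((j + 1 : ℝ) + 1)) (hir : fold (mean μ) i ≤ r)
    (hsr : s ≤ 8 * r * √n) :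
    excess n μ s i ≤ ENNReal.ofReal (s * (1 / ((j + 1 : ℝ) + 1) ^ 2)) := by
  have hn' : (0 : ℝ) < n := by positivity
  have hsq : √(n : ℝ) ^ 2 = n := Real.sq_sqrt hn'.le
  have hsn : 0 < √(n : ℝ) := Real.sqrt_pos.2 hn'
  have hL := half_le_log j
  have hL0 : 0 < Real.log ((j + 1 : ℝ) + 1) := by linarith
  set L := Real.log ((j + 1 : ℝ) + 1) with hLdef
  have hrL : r * L ≤ S₀ := by rwa [le_div_iff₀ hL0] at hrS
  set θ : ℝ := s / (8 * r * √n) with hθ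
  have hθ0 : 0 < θ := by positivity
  have hθ1 : θ ≤ 1 := by rw [hθ, div_le_one (by positivity)]; exact hsr
  refine (excess_le μ hn s i hθ0 hir).trans (ENNReal.ofReal_le_ofReal ?_)
  have hφ : Real.exp θ - 1 - θ ≤ θ ^ 2 :=
    (le_abs_self _).trans (Real.abs_exp_sub_one_sub_id_le (by rwa [abs_of_pos hθ0]))
  -- This needs `16 r ≤ s ^ 2`; since `L ≥ 1 / 2` gives `r ≤ 2 S₀`, the constant `32` suffices.
  have h1 : 2 / (θ * √n) ≤ s := by
    have : 2 / (θ * √n) = 16 * r / s := by rw [hθ]; field_simp; norm_num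
    rw [this, div_le_iff₀ hs]
    nlinarith
  have h2 : n * (r * (Real.exp θ - 1 - θ)) - θ * √n * s ≤ -(2 * L) := by
    have h3 : n * (r * (Real.exp θ - 1 - θ)) ≤ n * (r * θ ^ 2) := by gcongr
    have h4 : n * (r * θ ^ 2) - θ * √n * s = -(7 * s ^ 2 / (64 * r)) := by
      rw [hθ]; field_simp; rw [hsq]; ring
    have h5 : 2 * L ≤ 7 * s ^ 2 / (64 * r) := by
      rw [le_div_iff₀ (by positivity), hsS]
      nlinarith
    linarith
  have h6 : Real.exp (-(2 * L)) = 1 / ((j + 1 : ℝ) + 1) ^ 2 := by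
    rw [Real.exp_neg, two_mul, Real.exp_add, hLdef, Real.exp_log (by positivity), one_div, sq]
  rw [← h6]
  gcongr

/-- Poisson regime: `θ` is chosen so that `n r exp θ = √n s / 2 = M`, half of what multiplies `θ` in
the Chernoff exponent. The exponent is split so that `exp (-m θ)` produces `r ^ m`, summable in `j`
since `a m ≥ 2`, and the remaining `exp (-(M - m))` beats the power of `n`. -/
lemma excess_le_of_rare (μ : Measure Cube) [IsProbabilityMeasure μ] {n : ℕ} (hn : 0 < n)
    {s r a : ℝ} {i j m : ℕ} (hs : 0 < s) (hr : 0 < r) (ham : 2 ≤ a * m)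
    (hra : r ≤ ((j + 1 : ℝ) + 1) ^ (-a)) (hir : fold (mean μ) i ≤ r)
    (hsr : 8 * r * √n ≤ s) (hm : m ≤ √n * s / 2) :
    excess n μ s i ≤ ENNReal.ofReal
      (2 * Real.exp (-(√n * s / 2 - m)) * (2 * √n / s) ^ m * (1 / ((j + 1 : ℝ) + 1) ^ 2)) := by
  have hn' : (0 : ℝ) < n := by positivity
  have hsq : √(n : ℝ) ^ 2 = n := Real.sq_sqrt hn'.le
  have hsn : 1 ≤ √(n : ℝ) := Real.one_le_sqrt.2 (by exact_mod_cast hn)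
  have hj : (1 : ℝ) ≤ (j + 1 : ℝ) + 1 := by linarith [(Nat.cast_nonneg j : (0 : ℝ) ≤ j)]
  set x : ℝ := s / (2 * √n * r) with hx
  have hx0 : 0 < x := by positivity
  have hx4 : 4 ≤ x := by rw [hx, le_div_iff₀ (by positivity)]; linarith
  set θ : ℝ := Real.log x with hθ
  have hexp : Real.exp θ = x := Real.exp_log hx0
  have hθ1 : 1 ≤ θ := by
    rw [hθ, Real.le_log_iff_exp_le hx0]
    linarith [Real.exp_one_lt_d9]
  refine (excess_le μ hn s i (θ := θ) (by linarith) hir).trans (ENNReal.ofReal_le_ofReal ?_)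
  set M : ℝ := √n * s / 2 with hM
  have h1 : 2 / (θ * √n) ≤ 2 := by
    rw [div_le_iff₀ (by positivity)]
    nlinarith [mul_le_mul hθ1 hsn zero_le_one (by linarith)]
  have h2 : n * (r * (Real.exp θ - 1 - θ)) - θ * √n * s ≤ -(M - m) + -(m * θ) := by
    have h3 : n * (r * (Real.exp θ - 1 - θ)) ≤ n * (r * x) := by
      gcongr; rw [hexp]; linarith
    have h4 : n * (r * x) = M := by rw [hx, hM]; field_simp; rw [hsq]
    have h5 : θ * √n * s = 2 * θ * M := by rw [hM]; ring
    have h6 : 0 ≤ (θ - 1) * (M - m) := mul_nonneg (by linarith) (by linarith)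
    have hM0 : 0 ≤ (θ - 1) * M := mul_nonneg (by linarith) (by positivity)
    nlinarith
  have h7 : Real.exp (-(m * θ)) ≤ (2 * √n / s) ^ m * (1 / ((j + 1 : ℝ) + 1) ^ 2) := by
    have h8 : Real.exp (-(m * θ)) = (2 * √n / s) ^ m * r ^ m := by
      rw [Real.exp_neg, Real.exp_nat_mul, hexp, ← inv_pow, ← mul_pow, hx]
      congr 1
      field_simp
    rw [h8]
    gcongr
    calc r ^ m ≤ (((j + 1 : ℝ) + 1) ^ (-a)) ^ m := by gcongr
      _ = ((j + 1 : ℝ) + 1) ^ (-(a * m)) := by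
        rw [← Real.rpow_mul_natCast (by positivity)]; ring_nf
      _ ≤ ((j + 1 : ℝ) + 1) ^ (-(2 : ℕ) : ℝ) :=
        Real.rpow_le_rpow_of_exponent_le hj (by push_cast; linarith)
      _ = _ := by rw [Real.rpow_neg (by positivity), Real.rpow_natCast, one_div]
  calc _ ≤ 2 * Real.exp (-(M - m) + -(m * θ)) :=
        mul_le_mul h1 (Real.exp_le_exp.2 h2) (Real.exp_nonneg _) zero_le_two
    _ = 2 * Real.exp (-(M - m)) * Real.exp (-(m * θ)) := by rw [Real.exp_add]; ring
    _ ≤ 2 * Real.exp (-(M - m)) * ((2 * √n / s) ^ m * (1 / ((j + 1 : ℝ) + 1) ^ 2)) := by gcongr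
    _ = _ := by ring

lemma tendsto_rare_bound {s : ℝ} (hs : 0 < s) (m : ℕ) :
    Tendsto (fun n : ℕ => 2 * Real.exp (-(√n * s / 2 - m)) * (2 * √n / s) ^ m) atTop (𝓝 0) := by
  have h1 : Tendsto (fun n : ℕ => √(n : ℝ) * s / 2) atTop atTop := by
    have : Tendsto (fun n : ℕ => √(n : ℝ)) atTop atTop :=
      Real.tendsto_sqrt_atTop.comp tendsto_natCast_atTop_atTop
    exact (this.atTop_mul_const hs).atTop_div_const two_pos
  have h2 := ((Real.tendsto_pow_mul_exp_neg_atTop_nhds_zero m).comp h1).const_mul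
    (2 * Real.exp m * (4 / s ^ 2) ^ m)
  rw [mul_zero] at h2
  refine h2.congr fun n => ?_
  have h3 : 2 * √(n : ℝ) / s = 4 / s ^ 2 * (√n * s / 2) := by field_simp; ring
  rw [h3, mul_pow, neg_sub, sub_eq_add_neg, Real.exp_add]
  simp only [Function.comp]
  ring

lemma summable_inv_sq : Summable fun j : ℕ => 1 / ((j + 1 : ℝ) + 1) ^ 2 := by
  have h := (summable_nat_add_iff 2).2 (Real.summable_one_div_nat_pow.2 (one_lt_two))
  refine h.congr fun j => ?_
  push_cast
  ring_nf

/-- The series `∑ 1 / (j + 2)²`. -/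
def invSqSum : ℝ := ∑' j : ℕ, 1 / ((j + 1 : ℝ) + 1) ^ 2

lemma invSqSum_nonneg : 0 ≤ invSqSum := tsum_nonneg fun j => by positivity

lemma limsup_le_of_bounds (μ : Measure Cube) [IsProbabilityMeasure μ]
    (ht : Tendsto (fold (mean μ)) atTop (𝓝 0)) {S₀ a : ℝ} (hS₀ : 0 < S₀) (ha : 0 < a)
    (hS : ∀ j, rearr (fold (mean μ)) j ≤ S₀ / Real.log ((j + 1 : ℝ) + 1))
    (hT : ∀ j, rearr (fold (mean μ)) j ≤ ((j + 1 : ℝ) + 1) ^ (-a)) :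
    limsup (fun n : ℕ => ENNReal.ofReal √n * Δ n μ) atTop ≤
      ENNReal.ofReal (√32 * (1 + invSqSum) * √S₀) := by
  obtain ⟨σ, hσ, hqσ⟩ := exists_injective_le_rearr ht
  -- `m` depends on `T` but not on `n`; it affects only the vanishing term `B n`, which keeps the
  -- final constant absolute.
  obtain ⟨m, hm⟩ := exists_nat_ge (2 / a)
  have ham : 2 ≤ a * m := by rwa [div_le_iff₀' ha] at hm
  set s : ℝ := √32 * √S₀ with hsdef
  have hs : 0 < s := by positivity
  have hsS : s ^ 2 = 32 * S₀ := by
    rw [hsdef, mul_pow, Real.sq_sqrt (by norm_num), Real.sq_sqrt hS₀.le]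
  set B : ℕ → ℝ := fun n => 2 * Real.exp (-(√n * s / 2 - m)) * (2 * √n / s) ^ m with hB
  have hB0 : ∀ n, 0 ≤ B n := fun n => by positivity
  have hBlim : Tendsto B atTop (𝓝 0) := tendsto_rare_bound hs m
  have hlarge : ∀ᶠ n : ℕ in atTop, (m : ℝ) ≤ √n * s / 2 := by
    have : Tendsto (fun n : ℕ => √(n : ℝ)) atTop atTop :=
      Real.tendsto_sqrt_atTop.comp tendsto_natCast_atTop_atTop
    exact ((this.atTop_mul_const hs).atTop_div_const two_pos).eventually_ge_atTop _
  have hmain : ∀ᶠ n : ℕ in atTop, ENNReal.ofReal √n * Δ n μ ≤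
      ENNReal.ofReal (s + (s + B n) * invSqSum) := by
    filter_upwards [hlarge, eventually_gt_atTop 0] with n hn hn0
    have hterm : ∀ i : {i // 0 < fold (mean μ) i}, excess n μ s i ≤
        ENNReal.ofReal ((s + B n) * (1 / ((σ i + 1 : ℝ) + 1) ^ 2)) := by
      intro i
      have hL : 0 < Real.log ((σ i + 1 : ℝ) + 1) := by linarith [half_le_log (σ i)]
      set r := min (S₀ / Real.log ((σ i + 1 : ℝ) + 1)) (((σ i + 1 : ℝ) + 1) ^ (-a)) with hr
      have hr0 : 0 < r := lt_min (by positivity) (by positivity)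
      have hir : fold (mean μ) i ≤ r := (hqσ i).trans (le_min (hS _) (hT _))
      rcases le_total s (8 * r * √n) with h | h
      · refine (excess_le_of_moderate μ hn0 hs hr0 hsS (min_le_left _ _) hir h).trans ?_
        gcongr
        linarith [hB0 n]
      · refine (excess_le_of_rare μ hn0 hs hr0 ham (min_le_right _ _) hir h hn).trans ?_
        gcongr
        linarith
    have hsum : ∑' j, excess n μ s j ≤ ENNReal.ofReal ((s + B n) * invSqSum) := by
      have hsupp : Function.support (excess n μ s) ⊆ {i | 0 < fold (mean μ) i} := by
        intro i hi
        by_contra h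
        exact hi (excess_eq_zero μ hn0 hs i (not_lt.1 h))
      calc ∑' j, excess n μ s j = ∑' i : {i // 0 < fold (mean μ) i}, excess n μ s i :=
            (tsum_subtype_eq_of_support_subset hsupp).symm
        _ ≤ ∑' i, ENNReal.ofReal ((s + B n) * (1 / ((σ i + 1 : ℝ) + 1) ^ 2)) :=
            ENNReal.tsum_le_tsum hterm
        _ ≤ ∑' j : ℕ, ENNReal.ofReal ((s + B n) * (1 / ((j + 1 : ℝ) + 1) ^ 2)) :=
            ENNReal.tsum_comp_le_tsum_of_injective hσ
              fun j : ℕ => ENNReal.ofReal ((s + B n) * (1 / ((j + 1 : ℝ) + 1) ^ 2))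
        _ = _ := by
            rw [← ENNReal.ofReal_tsum_of_nonneg _ (summable_inv_sq.mul_left _), tsum_mul_left,
              invSqSum]
            intro j
            have := hB0 n
            positivity
    refine (sqrt_mul_Δ_le μ n s).trans ?_
    rw [ENNReal.ofReal_add hs.le (mul_nonneg (by linarith [hB0 n]) invSqSum_nonneg)]
    gcongr
  have hlim : Tendsto (fun n => ENNReal.ofReal (s + (s + B n) * invSqSum)) atTop
      (𝓝 (ENNReal.ofReal (s + (s + 0) * invSqSum))) :=
    ENNReal.tendsto_ofReal (((hBlim.const_add s).mul_const _).const_add s)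
  calc _ ≤ limsup (fun n => ENNReal.ofReal (s + (s + B n) * invSqSum)) atTop :=
        limsup_le_limsup hmain
    _ = ENNReal.ofReal (s + (s + 0) * invSqSum) := hlim.limsup_eq
    _ = _ := by rw [hsdef]; ring_nf

lemma le_rpow_of_T_lt_top {p : ℕ → ℝ} (h0 : ∀ j, 0 ≤ p j) (h1 : ∀ j, p j ≤ 1 / 2)
    (hT : T p < ⊤) : ∃ a : ℝ, 0 < a ∧ ∀ j : ℕ, p j ≤ ((j + 1 : ℝ) + 1) ^ (-a) := by
  -- The `+ 1` keeps the exponent positive and finite when `T p = 0`.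
  refine ⟨((T p).toReal + 1)⁻¹, by positivity, fun j => ?_⟩
  rcases (h0 j).eq_or_lt with hj | hj
  · rw [← hj]; positivity
  have hlog : 0 < Real.log (1 / p j) := Real.log_pos (by
    rw [lt_div_iff₀ hj]; linarith [h1 j])
  have h2 : ENNReal.ofReal (Real.log ((j + 1 : ℝ) + 1) / Real.log (1 / p j)) ≤ T p := by
    have := le_iSup (fun j : ℕ => if p j = 0 then 0
      else ENNReal.ofReal (Real.log ((j + 1 : ℝ) + 1) / Real.log (1 / p j))) j
    rwa [if_neg hj.ne'] at this
  have h3 : Real.log ((j + 1 : ℝ) + 1) / Real.log (1 / p j) ≤ (T p).toReal + 1 := by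
    rw [ENNReal.ofReal_le_iff_le_toReal hT.ne] at h2
    linarith
  rw [div_le_iff₀ hlog] at h3
  have hT1 : 0 < (T p).toReal + 1 := by positivity
  rw [← Real.log_le_log_iff hj (by positivity), Real.log_rpow (by positivity)]
  rw [one_div, Real.log_inv] at h3
  have h4 : ((T p).toReal + 1)⁻¹ * Real.log ((j + 1 : ℝ) + 1) ≤ -Real.log (p j) := by
    rw [inv_mul_le_iff₀ hT1]; exact h3
  linarith

lemma fold_le_half (p : ℕ → ℝ) (j : ℕ) : fold p j ≤ 1 / 2 := by
  rcases le_total (p j) (1 / 2) with h | h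
  · exact (min_le_left _ _).trans h
  · exact (min_le_right _ _).trans (by linarith)

lemma limsup_le_of_T_lt_top (μ : Measure Cube) [IsProbabilityMeasure μ]
    (ht : Tendsto (fold (mean μ)) atTop (𝓝 0)) (hT : T (rearr (fold (mean μ))) < ⊤) :
    limsup (fun n : ℕ => ENNReal.ofReal √n * Δ n μ) atTop ≤
      ENNReal.ofReal (√32 * (1 + invSqSum)) * S (rearr (fold (mean μ))) ^ (1 / 2 : ℝ) := by
  set q := rearr (fold (mean μ)) with hq
  have hK : 0 < √32 * (1 + invSqSum) := by
    have := invSqSum_nonneg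
    positivity
  obtain ⟨a, ha, hra⟩ := le_rpow_of_T_lt_top (rearr_nonneg _)
    (rearr_le_of_le (by norm_num) (fold_le_half _)) hT
  rcases eq_or_ne (S q) ⊤ with hS | hS
  · rw [hS, ENNReal.top_rpow_of_pos (by norm_num), ENNReal.mul_top (by simpa using hK)]
    exact le_top
  have hbound : ∀ S₀ > (S q).toReal,
      limsup (fun n : ℕ => ENNReal.ofReal √n * Δ n μ) atTop ≤
        ENNReal.ofReal (√32 * (1 + invSqSum) * √S₀) := by
    intro S₀ hS₀
    refine limsup_le_of_bounds μ ht (ENNReal.toReal_nonneg.trans_lt hS₀) ha (fun j => ?_) hra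
    have hL := half_le_log j
    rw [le_div_iff₀ (by linarith)]
    have h1 : ENNReal.ofReal (q j * Real.log ((j + 1 : ℝ) + 1)) ≤ S q :=
      le_iSup (fun j : ℕ => ENNReal.ofReal (q j * Real.log ((j + 1 : ℝ) + 1))) j
    rw [ENNReal.ofReal_le_iff_le_toReal hS] at h1
    exact h1.trans hS₀.le
  -- `limsup_le_of_bounds` needs `S₀ > 0` while `S q` may vanish, so `S₀` descends to `S q` from
  -- above.
  have hlim : Tendsto (fun S₀ => ENNReal.ofReal (√32 * (1 + invSqSum) * √S₀))
      (𝓝[>] (S q).toReal) (𝓝 (ENNReal.ofReal (√32 * (1 + invSqSum) * √(S q).toReal))) := by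
    refine Tendsto.mono_left (Continuous.tendsto ?_ _) nhdsWithin_le_nhds
    exact ENNReal.continuous_ofReal.comp (Real.continuous_sqrt.const_mul _)
  refine (ge_of_tendsto hlim (eventually_mem_nhdsWithin.mono hbound)).trans_eq ?_
  rw [ENNReal.ofReal_mul hK.le, Real.sqrt_eq_rpow (S q).toReal,
    ← ENNReal.ofReal_rpow_of_nonneg ENNReal.toReal_nonneg (by norm_num), ENNReal.ofReal_toReal hS]

/-! ### Lower bounds for product measures -/

section Product

variable (ν : ℕ → Measure Bool) [∀ j, IsProbabilityMeasure (ν j)]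

/-- Transposition of the sample: independent infinite columns realise the samples of every size on
one space, where the central limit theorem can be applied column by column. -/
lemma map_columns_eq_pi (n : ℕ) :
    (Measure.infinitePi fun j => Measure.infinitePi fun _ : ℕ => ν j).map
        (fun ω (i : Fin n) j => ω j i) =
      Measure.pi fun _ : Fin n => Measure.infinitePi ν := by
  have hf : Function.Injective fun q : Fin n × ℕ => (q.2, (q.1 : ℕ)) := by
    rintro ⟨a, b⟩ ⟨c, d⟩ h
    simp only [Prod.mk.injEq, Fin.val_inj] at h
    simp [h.1, h.2]
  rw [← Measure.infinitePi_eq_pi, ← Measure.infinitePi_map_curry fun (_ : Fin n) j => ν j,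
    ← Measure.map_infinitePi_infinitePi_of_inj (P := fun p : ℕ × ℕ => ν p.1) hf,
    ← Measure.infinitePi_map_curry_symm fun (j : ℕ) (_ : ℕ) => ν j,
    Measure.map_map (by fun_prop) (by fun_prop), Measure.map_map (by fun_prop) (by fun_prop)]
  rfl

lemma mean_infinitePi (j : ℕ) : mean (Measure.infinitePi ν) j = (ν j).real {true} := by
  rw [mean, ← integral_map (φ := fun x : Cube => x j) (f := bit)
    (measurable_pi_apply j).aemeasurable
    measurable_bit.aestronglyMeasurable, Measure.infinitePi_map_eval]
  rw [show bit = Set.indicator {true} 1 by funext b; cases b <;> simp [bit]]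
  exact integral_indicator_one (measurableSet_singleton _)

/-- `(1 - a)(1 + a) ≤ 1`, and Bernoulli's inequality bounds `(1 + a) ^ N` from below. -/
lemma one_sub_div_pow_le {κ : ℝ} (h0 : 0 ≤ κ) (h1 : κ ≤ 1) {N : ℕ} (hN : 1 ≤ N) :
    (1 - κ / (N + 1)) ^ N ≤ 1 / (1 + κ / 2) := by
  have hN' : (1 : ℝ) ≤ N := by exact_mod_cast hN
  set a : ℝ := κ / (N + 1) with ha
  have ha0 : 0 ≤ a := by positivity
  have ha1 : a ≤ 1 := by rw [ha, div_le_one (by positivity)]; linarith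
  have haN : κ / 2 ≤ N * a := by
    rw [ha, ← mul_div_assoc, le_div_iff₀ (by positivity)]
    nlinarith
  have h2 : 1 + κ / 2 ≤ (1 + a) ^ N := by
    linarith [one_add_mul_le_pow (by linarith : (-2 : ℝ) ≤ a) N]
  rw [le_div_iff₀ (by positivity)]
  calc (1 - a) ^ N * (1 + κ / 2) ≤ (1 - a) ^ N * (1 + a) ^ N := by
        gcongr
    _ = (1 - a ^ 2) ^ N := by rw [← mul_pow]; ring
    _ ≤ 1 := pow_le_one₀ (by nlinarith) (by nlinarith)

/-- The deviation from `m` of the mean of the first `n` bits of a sequence. -/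
def columnDev (n : ℕ) (m : ℝ) (y : ℕ → Bool) : ℝ :=
  (n : ℝ)⁻¹ * ∑ i ∈ Finset.range n, bit (y i) - m

lemma measurable_columnDev (n : ℕ) (m : ℝ) : Measurable (columnDev n m) := by
  unfold columnDev
  refine (Measurable.const_mul (Finset.measurable_fun_sum _ fun i _ => ?_) _).sub_const _
  exact measurable_bit.comp (measurable_pi_apply i)

/-- By independence, all `N` columns stay within `t` with probability at most `(1 - κ / (N + 1)) ^
N`; Markov's inequality concludes. -/
lemma ofReal_le_Δ_of_columns {n N : ℕ} {t κ : ℝ} (h0 : 0 ≤ κ) (h1 : κ ≤ 1) (hN : 1 ≤ N)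
    (h : ∀ i < N, κ / (N + 1) ≤ (Measure.infinitePi fun _ : ℕ => ν i).real
      {y | t ≤ |columnDev n (mean (Measure.infinitePi ν) i) y|}) :
    ENNReal.ofReal t * ENNReal.ofReal (1 - 1 / (1 + κ / 2)) ≤ Δ n (Measure.infinitePi ν) := by
  set μ := Measure.infinitePi ν with hμ
  set P := Measure.infinitePi fun j => Measure.infinitePi fun _ : ℕ => ν j with hP
  set A : ℕ → Set (ℕ → Bool) := fun i => {y | t ≤ |columnDev n (mean μ i) y|} with hA
  have hAm : ∀ i, MeasurableSet (A i) := fun i =>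
    measurableSet_le measurable_const (measurable_columnDev n _).abs
  set F : Set (ℕ → ℕ → Bool) := Set.pi (Finset.range N) fun i => (A i)ᶜ with hF
  have hFm : MeasurableSet F := MeasurableSet.pi (Finset.countable_toSet _) fun i _ => (hAm i).compl
  have hPF : P.real F ≤ 1 / (1 + κ / 2) := by
    have h2 : P.real F = ∏ i ∈ Finset.range N,
        (1 - (Measure.infinitePi fun _ : ℕ => ν i).real (A i)) := by
      rw [measureReal_def, hP, hF, Measure.infinitePi_pi _ fun i _ => (hAm i).compl,
        ENNReal.toReal_prod]
      refine Finset.prod_congr rfl fun i _ => ?_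
      rw [← measureReal_def, probReal_compl_eq_one_sub (hAm i)]
    rw [h2]
    refine le_trans ?_ (one_sub_div_pow_le h0 h1 hN)
    rw [← Finset.card_range N, ← Finset.prod_const, Finset.card_range]
    refine Finset.prod_le_prod (fun i _ => ?_) fun i hi => ?_
    · linarith [measureReal_le_one (μ := Measure.infinitePi fun _ : ℕ => ν i) (s := A i)]
    · linarith [h i (Finset.mem_range.1 hi)]
  have hPE : ENNReal.ofReal (1 - 1 / (1 + κ / 2)) ≤ P Fᶜ := by
    rw [← ofReal_measureReal, probReal_compl_eq_one_sub hFm]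
    exact ENNReal.ofReal_le_ofReal (by linarith)
  have hfm : Measurable fun X : Fin n → Cube =>
      ⨆ j, ENNReal.ofReal |empMean X j - mean μ j| :=
    Measurable.iSup fun j => ENNReal.measurable_ofReal.comp
      ((measurable_empMean j).sub_const _).abs
  have hΦ : Measurable fun (ω : ℕ → ℕ → Bool) (i : Fin n) (j : ℕ) => ω j i := by fun_prop
  rw [Δ, hμ, ← map_columns_eq_pi, ← hμ, ← hP, lintegral_map hfm hΦ]
  refine le_trans ?_ (mul_meas_ge_le_lintegral (hfm.comp hΦ) (ENNReal.ofReal t))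
  refine mul_le_mul_right (hPE.trans (measure_mono fun ω hω => ?_)) _
  simp only [hF, Set.mem_compl_iff, Set.mem_pi, not_forall, not_not] at hω
  obtain ⟨i, _, hi⟩ := hω
  refine le_trans ?_ (le_iSup (fun j : ℕ => ENNReal.ofReal
    |empMean (fun (k : Fin n) (j : ℕ) => ω j k) j - mean μ j|) i)
  refine ENNReal.ofReal_le_ofReal (le_trans hi (le_of_eq ?_))
  simp only [columnDev, empMean, Finset.sum_range]

lemma infinitePi_all_true (i n : ℕ) :
    (Measure.infinitePi fun _ : ℕ => ν i).real {y | ∀ k < n, y k = true} =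
      (ν i).real {true} ^ n := by
  have : {y : ℕ → Bool | ∀ k < n, y k = true} = Set.pi (Finset.range n) fun _ => {true} := by
    ext y; simp
  rw [this, measureReal_def, Measure.infinitePi_pi _ fun _ _ => measurableSet_singleton _]
  simp [measureReal_def]

/-- If `T = ∞`, each `n` has a `j` with `p(j) ^ n ≥ 1 / (j + 2)`. Each of the first `j + 1` columns
then consists of ones with at least this probability, and so deviates by `1 - p(i) ≥ 1 / 2`. Hence
`Δₙ` stays above a positive constant. -/
lemma T_mean_lt_top (hp : ∀ j, mean (Measure.infinitePi ν) j ∈ Set.Icc (0 : ℝ) (1 / 2))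
    (hanti : Antitone (mean (Measure.infinitePi ν)))
    (hlim : Tendsto (fun n => Δ n (Measure.infinitePi ν)) atTop (𝓝 0)) :
    T (mean (Measure.infinitePi ν)) < ⊤ := by
  set p := mean (Measure.infinitePi ν) with hpdef
  by_contra hT
  have hT' : T p = ⊤ := not_lt_top_iff.1 hT
  have hlow : ∀ n : ℕ, 0 < n → ENNReal.ofReal (1 / 2) * ENNReal.ofReal (1 - 1 / (1 + 1 / 2)) ≤
      Δ n (Measure.infinitePi ν) := by
    intro n hn
    obtain ⟨j, hj⟩ := iSup_eq_top.1 hT' n (ENNReal.natCast_lt_top n)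
    have hpj : p j ≠ 0 := fun h => by simp [h] at hj
    rw [if_neg hpj] at hj
    have hpj0 : 0 < p j := lt_of_le_of_ne (hp j).1 hpj.symm
    have hlog : 0 < Real.log (1 / p j) := Real.log_pos (by
      rw [lt_div_iff₀ hpj0]; linarith [(hp j).2])
    have h1 : (n : ℝ) < Real.log ((j + 1 : ℝ) + 1) / Real.log (1 / p j) := by
      rw [← ENNReal.ofReal_natCast] at hj
      exact (ENNReal.ofReal_lt_ofReal_iff_of_nonneg (Nat.cast_nonneg n)).1 hj
    rw [lt_div_iff₀ hlog, ← Real.log_pow, Real.log_lt_log_iff (by positivity) (by positivity),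
      one_div, inv_pow] at h1
    have h2 : 1 / ((j + 1 : ℝ) + 1) ≤ p j ^ n := by
      rw [one_div]
      exact (inv_lt_of_inv_lt₀ (by positivity) h1).le
    refine ofReal_le_Δ_of_columns ν (N := j + 1) zero_le_one le_rfl (by omega) fun i hi => ?_
    push_cast
    refine h2.trans ((pow_le_pow_left₀ hpj0.le (hanti (Nat.lt_succ_iff.1 hi)) n).trans ?_)
    rw [hpdef, mean_infinitePi ν i, ← infinitePi_all_true]
    refine measureReal_mono fun y hy => ?_
    have hsum : ∑ k ∈ Finset.range n, bit (y k) = n := by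
      rw [Finset.sum_congr rfl fun k hk => by rw [hy k (Finset.mem_range.1 hk)]]
      simp [bit]
    have hn' : (n : ℝ) ≠ 0 := by positivity
    have h3 : columnDev n (p i) y = 1 - p i := by
      rw [columnDev, hsum, inv_mul_cancel₀ hn']
    change 1 / 2 ≤ |columnDev n ((ν i).real {true}) y|
    rw [← mean_infinitePi ν i, ← hpdef, h3]
    exact le_trans (by linarith [(hp i).2]) (le_abs_self _)
  have h4 := ge_of_tendsto hlim ((eventually_gt_atTop 0).mono hlow)
  rw [← ENNReal.ofReal_mul (by norm_num)] at h4
  simp at h4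
  norm_num at h4

end Product

/-! ### Gaussian comparison -/

/-- Integrate the density over `(s, s + 1)`, where `x ^ 2 / 2 ≤ s ^ 2 + 1`. The inequality is strict
so that it survives, for large `n`, the passage through a liminf. -/
lemma exists_gaussian_tail_lower_bound : ∃ κ : ℝ, 0 < κ ∧ κ ≤ 1 ∧ ∀ s : ℝ, 0 ≤ s →
    ENNReal.ofReal (κ * Real.exp (-s ^ 2)) < gaussianReal 0 1 {x | s < |x|} := by
  have hpi : 1 ≤ √(2 * Real.pi) := Real.one_le_sqrt.2 (by linarith [Real.pi_gt_three])
  set C : ℝ := (√(2 * Real.pi))⁻¹ * Real.exp (-1) with hC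
  have hC0 : 0 < C := by positivity
  have hC1 : C ≤ 1 := mul_le_one₀ (inv_le_one_of_one_le₀ hpi) (Real.exp_nonneg _)
    (Real.exp_le_one_iff.2 (by norm_num))
  refine ⟨C / 2, by positivity, by linarith, fun s hs => ?_⟩
  have hpdf : ∀ x ∈ Set.Ioo s (s + 1),
      ENNReal.ofReal (C * Real.exp (-s ^ 2)) ≤ gaussianPDF 0 1 x := by
    intro x hx
    refine ENNReal.ofReal_le_ofReal ?_
    rw [gaussianPDFReal, hC, mul_assoc, ← Real.exp_add]
    simp only [NNReal.coe_one, mul_one, sub_zero]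
    gcongr
    nlinarith [hx.1, hx.2, sq_nonneg (s - 1)]
  calc ENNReal.ofReal (C / 2 * Real.exp (-s ^ 2)) < ENNReal.ofReal (C * Real.exp (-s ^ 2)) := by
        rw [ENNReal.ofReal_lt_ofReal_iff (by positivity)]
        gcongr
        linarith
    _ = ∫⁻ _ in Set.Ioo s (s + 1), ENNReal.ofReal (C * Real.exp (-s ^ 2)) := by
        simp
    _ ≤ ∫⁻ x in Set.Ioo s (s + 1), gaussianPDF 0 1 x :=
        setLIntegral_mono (measurable_gaussianPDF 0 1) hpdf
    _ = gaussianReal 0 1 (Set.Ioo s (s + 1)) := (gaussianReal_apply 0 one_ne_zero _).symm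
    _ ≤ _ := measure_mono fun x hx => hx.1.trans_le (le_abs_self x)

/-- Central limit theorem and the portmanteau inequality for the open set `{x | t < |x|}`. -/
lemma eventually_le_columnDev (ν : Measure Bool) [IsProbabilityMeasure ν] {p s t b : ℝ}
    (hp : p = ν.real {true}) (hp0 : 0 < p) (hp1 : p < 1) (hts : t ≤ s * √(p * (1 - p)))
    (hb : ENNReal.ofReal b < gaussianReal 0 1 {x | s < |x|}) :
    ∀ᶠ n : ℕ in atTop, b ≤ (Measure.infinitePi fun _ : ℕ => ν).real
      {y | t ≤ √n * |columnDev n p y|} := by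
  set P := Measure.infinitePi fun _ : ℕ => ν with hP
  set X : ℕ → (ℕ → Bool) → ℝ := fun k y => bit (y k) with hX
  have hXm : ∀ k, Measurable (X k) := fun k => measurable_bit.comp (measurable_pi_apply k)
  have hv : 0 < p * (1 - p) := mul_pos hp0 (by linarith)
  have hmap : ∀ k, P.map (X k) = ν.map bit := by
    intro k
    rw [show X k = bit ∘ fun y => y k from rfl,
      ← Measure.map_map measurable_bit (measurable_pi_apply k), hP, Measure.infinitePi_map_eval]
  have hident : ∀ k, IdentDistrib (X k) (X 0) P P := fun k =>
    ⟨(hXm k).aemeasurable, (hXm 0).aemeasurable, by rw [hmap, hmap]⟩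
  have hindep : iIndepFun X P := iIndepFun_infinitePi (X := fun _ => bit) fun _ => measurable_bit
  have hmem : MemLp (X 0) 2 P := by
    refine MemLp.of_bound (hXm 0).aestronglyMeasurable 1 (ae_of_all _ fun y => ?_)
    rw [Real.norm_of_nonneg (bit_nonneg _)]
    exact bit_le_one _
  have hmean : P[X 0] = p := by
    have := mean_infinitePi (fun _ : ℕ => ν) 0
    rw [hp, ← this]
    rfl
  have hvar : Var[X 0; P] = p * (1 - p) := by
    have hsq : X 0 ^ 2 = X 0 := by
      funext y
      simp only [hX, Pi.pow_apply]
      cases y 0 <;> simp [bit]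
    rw [variance_eq_sub hmem, hsq, hmean]
    ring
  have hlaw : HasLaw (fun x : ℝ => √(p * (1 - p)) * x)
      (gaussianReal 0 Var[X 0; P].toNNReal) (gaussianReal 0 1) := by
    refine ⟨by fun_prop, ?_⟩
    rw [gaussianReal_map_const_mul, hvar]
    congr 1
    · simp
    · ext
      simp [Real.sq_sqrt hv.le, hv.le]
  have hclt := (tendstoInDistribution_inv_sqrt_mul_sum_sub hlaw hmem hindep hident).tendsto
  have hopen : IsOpen {x : ℝ | t < |x|} := isOpen_lt continuous_const continuous_abs
  have hport := ProbabilityMeasure.le_liminf_measure_open_of_tendsto hclt hopen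
  have hlt : ENNReal.ofReal b <
      ((gaussianReal 0 1).map fun x : ℝ => √(p * (1 - p)) * x) {x : ℝ | t < |x|} := by
    rw [Measure.map_apply (by fun_prop) hopen.measurableSet]
    refine hb.trans_le (measure_mono fun x hx => ?_)
    simp only [Set.mem_preimage, Set.mem_ofPred_eq, abs_mul, abs_of_nonneg (Real.sqrt_nonneg _)]
      at hx ⊢
    have := mul_lt_mul_of_pos_left hx (Real.sqrt_pos.2 hv)
    linarith
  filter_upwards [eventually_lt_of_lt_liminf (hlt.trans_le hport), eventually_gt_atTop 0]
    with n hn hn0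
  have hn1 : (0 : ℝ) < n := by positivity
  have hsn : 0 < √(n : ℝ) := Real.sqrt_pos.2 hn1
  have hsq : √(n : ℝ) ^ 2 = n := Real.sq_sqrt hn1.le
  have hZ : Measurable fun y => (√(n : ℝ))⁻¹ * (∑ k ∈ Finset.range n, X k y - n * P[X 0]) :=
    ((Finset.measurable_fun_sum _ fun k _ => hXm k).sub_const _).const_mul _
  change ENNReal.ofReal b < P.map _ {x : ℝ | t < |x|} at hn
  rw [Measure.map_apply hZ hopen.measurableSet] at hn
  rw [← ENNReal.ofReal_le_ofReal_iff measureReal_nonneg, ofReal_measureReal]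
  refine hn.le.trans (measure_mono fun y hy => ?_)
  rw [hmean] at hy
  have hdev : (√(n : ℝ))⁻¹ * (∑ k ∈ Finset.range n, X k y - n * p) = √n * columnDev n p y := by
    rw [columnDev, hX]
    field_simp
    rw [hsq]
  have hy' : t < |(√(n : ℝ))⁻¹ * (∑ k ∈ Finset.range n, X k y - n * p)| := hy
  rw [hdev, abs_mul, abs_of_pos hsn] at hy'
  exact hy'.le

/-- The constant of the lower bound, in terms of the constant of a Gaussian tail bound. -/
def lowerConst (κ : ℝ) : ℝ := (1 - 1 / (1 + κ / 2)) * √(1 / 2)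

lemma lowerConst_pos {κ : ℝ} (hκ : 0 < κ) : 0 < lowerConst κ := by
  have : 1 / (1 + κ / 2) < 1 := by rw [div_lt_one (by positivity)]; linarith
  exact mul_pos (by linarith) (by positivity)

/-- With `s = √(log (j + 2))` the Gaussian tail is at least `κ / (j + 2)`, as
`ofReal_le_Δ_of_columns` requires for `N = j + 1`. The deviation uses `p(i) (1 - p(i)) ≥ p(j) / 2`
for `i ≤ j`. -/
lemma ofReal_sqrt_le_liminf (ν : ℕ → Measure Bool) [∀ j, IsProbabilityMeasure (ν j)]
    (hp : ∀ j, mean (Measure.infinitePi ν) j ∈ Set.Icc (0 : ℝ) (1 / 2))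
    (hanti : Antitone (mean (Measure.infinitePi ν))) {κ : ℝ} (hκ0 : 0 < κ) (hκ1 : κ ≤ 1)
    (hκ : ∀ s : ℝ, 0 ≤ s →
      ENNReal.ofReal (κ * Real.exp (-s ^ 2)) < gaussianReal 0 1 {x | s < |x|}) (j : ℕ) :
    ENNReal.ofReal (lowerConst κ *
        √(mean (Measure.infinitePi ν) j * Real.log ((j + 1 : ℝ) + 1))) ≤
      liminf (fun n : ℕ => ENNReal.ofReal √n * Δ n (Measure.infinitePi ν)) atTop := by
  set p := mean (Measure.infinitePi ν) with hpdef
  set L := Real.log ((j + 1 : ℝ) + 1) with hL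
  have hL0 : 0 < L := by linarith [half_le_log j]
  rcases (hp j).1.eq_or_lt with hj | hj
  · rw [← hj]; simp
  set t : ℝ := √L * √(p j / 2) with ht
  have htail := hκ √L (Real.sqrt_nonneg _)
  have hbound : κ * Real.exp (-√L ^ 2) = κ / (((j + 1 : ℕ) : ℝ) + 1) := by
    rw [Real.sq_sqrt hL0.le, Real.exp_neg, hL, Real.exp_log (by positivity)]
    push_cast
    ring
  rw [hbound] at htail
  have hev : ∀ᶠ n : ℕ in atTop, ∀ i < j + 1, κ / (((j + 1 : ℕ) : ℝ) + 1) ≤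
      (Measure.infinitePi fun _ : ℕ => ν i).real {y | t ≤ √n * |columnDev n (p i) y|} := by
    have : ∀ i ∈ Set.Iio (j + 1), ∀ᶠ n : ℕ in atTop, κ / (((j + 1 : ℕ) : ℝ) + 1) ≤
        (Measure.infinitePi fun _ : ℕ => ν i).real {y | t ≤ √n * |columnDev n (p i) y|} := by
      intro i hi
      have hji : p j ≤ p i := hanti (Nat.lt_succ_iff.1 hi)
      refine eventually_le_columnDev (ν i) (mean_infinitePi ν i) (hj.trans_le hji)
        (by linarith [(hp i).2]) ?_ htail
      rw [ht]
      gcongr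
      nlinarith [(hp i).2]
    exact (eventually_all_finite (Set.finite_Iio (j + 1))).2 this
  refine le_liminf_of_le (by isBoundedDefault) ?_
  filter_upwards [hev, eventually_gt_atTop 0] with n hn hn0
  have hsn : 0 < √(n : ℝ) := Real.sqrt_pos.2 (by positivity)
  have h1 := ofReal_le_Δ_of_columns ν (n := n) (N := j + 1) (t := t / √n) hκ0.le hκ1 (by omega)
    (fun i hi => by
      refine (hn i hi).trans (measureReal_mono fun y hy => ?_)
      exact (div_le_iff₀' hsn).2 hy)
  refine le_trans (le_of_eq ?_) (mul_le_mul_right h1 _)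
  rw [← mul_assoc, ← ENNReal.ofReal_mul hsn.le, mul_div_cancel₀ _ hsn.ne',
    ← ENNReal.ofReal_mul (by positivity), ht, lowerConst, ← Real.sqrt_mul hL0.le]
  congr 1
  rw [mul_assoc, ← Real.sqrt_mul (by norm_num), mul_comm]
  ring_nf

lemma lowerConst_mul_le_liminf (ν : ℕ → Measure Bool) [∀ j, IsProbabilityMeasure (ν j)]
    (hp : ∀ j, mean (Measure.infinitePi ν) j ∈ Set.Icc (0 : ℝ) (1 / 2))
    (hanti : Antitone (mean (Measure.infinitePi ν))) {κ : ℝ} (hκ0 : 0 < κ) (hκ1 : κ ≤ 1)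
    (hκ : ∀ s : ℝ, 0 ≤ s →
      ENNReal.ofReal (κ * Real.exp (-s ^ 2)) < gaussianReal 0 1 {x | s < |x|}) :
    ENNReal.ofReal (lowerConst κ) * S (mean (Measure.infinitePi ν)) ^ (1 / 2 : ℝ) ≤
      liminf (fun n : ℕ => ENNReal.ofReal √n * Δ n (Measure.infinitePi ν)) atTop := by
  have hc := lowerConst_pos hκ0
  have hc0 : ENNReal.ofReal (lowerConst κ) ≠ 0 := by simpa using hc
  rw [mul_comm, ← ENNReal.le_div_iff_mul_le (Or.inl hc0) (Or.inl ENNReal.ofReal_ne_top),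
    one_div, ENNReal.rpow_inv_le_iff two_pos]
  refine iSup_le fun j => ?_
  rw [← ENNReal.rpow_inv_le_iff two_pos,
    ENNReal.le_div_iff_mul_le (Or.inl hc0) (Or.inl ENNReal.ofReal_ne_top), mul_comm]
  refine le_trans (le_of_eq ?_) (ofReal_sqrt_le_liminf ν hp hanti hκ0 hκ1 hκ j)
  have hpj := (hp j).1
  have hL := half_le_log j
  rw [ENNReal.ofReal_rpow_of_nonneg (mul_nonneg hpj (by linarith)) (by norm_num),
    ← ENNReal.ofReal_mul hc.le, Real.sqrt_eq_rpow, one_div]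

lemma mean_bernoulliProduct {p : ℕ → ℝ} (hp : ∀ j, p j ∈ Set.Icc (0 : ℝ) 1) :
    mean (bernoulliProduct p) = p := by
  funext j
  rw [bernoulliProduct, mean_infinitePi,
    bernoulliMeasure_real_apply_of_mem_of_notMem _ (by simp) (by simp) (by simp)]
  rw [Set.projIcc_of_mem zero_le_one (hp j)]

end LocalGC

end

theorem mainTheorem2 :
    ∃ c c' : ℝ≥0, 0 < c ∧ 0 < c' ∧
      (∀ μ : Measure LocalGC.Cube, IsProbabilityMeasure μ → LocalGC.IsProduct μ →
        LocalGC.mean μ ∈ LocalGC.LGC →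
          (c : ℝ≥0∞) * LocalGC.S (LocalGC.mean μ) ^ (1 / 2 : ℝ)
              ≤ liminf (fun n : ℕ => ENNReal.ofReal (√(n : ℝ)) * LocalGC.Δ n μ) atTop ∧
          liminf (fun n : ℕ => ENNReal.ofReal (√(n : ℝ)) * LocalGC.Δ n μ) atTop
              ≤ limsup (fun n : ℕ => ENNReal.ofReal (√(n : ℝ)) * LocalGC.Δ n μ) atTop ∧
          limsup (fun n : ℕ => ENNReal.ofReal (√(n : ℝ)) * LocalGC.Δ n μ) atTop
              ≤ (c' : ℝ≥0∞) * LocalGC.S (LocalGC.mean μ) ^ (1 / 2 : ℝ)) ∧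
      (∀ μ : Measure LocalGC.Cube, IsProbabilityMeasure μ → LocalGC.measT μ < ⊤ →
        limsup (fun n : ℕ => ENNReal.ofReal (√(n : ℝ)) * LocalGC.Δ n μ) atTop
          ≤ (c' : ℝ≥0∞) * LocalGC.measS μ ^ (1 / 2 : ℝ)) := by
  obtain ⟨κ, hκ0, hκ1, hκ⟩ := LocalGC.exists_gaussian_tail_lower_bound
  have hK : 0 < √32 * (1 + LocalGC.invSqSum) := by
    have := LocalGC.invSqSum_nonneg
    positivity
  refine ⟨(LocalGC.lowerConst κ).toNNReal, (√32 * (1 + LocalGC.invSqSum)).toNNReal,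
    Real.toNNReal_pos.2 (LocalGC.lowerConst_pos hκ0), Real.toNNReal_pos.2 hK, ?_, ?_⟩
  · rintro μ _ ⟨ν, _, rfl⟩ ⟨⟨hp, hanti, hlim⟩, hΔ⟩
    refine ⟨LocalGC.lowerConst_mul_le_liminf ν hp hanti hκ0 hκ1 hκ, liminf_le_limsup, ?_⟩
    set p := LocalGC.mean (Measure.infinitePi ν) with hpdef
    have hfold : LocalGC.fold p = p := by
      funext j
      exact min_eq_left (by linarith [(hp j).2])
    have hrearr : LocalGC.rearr (LocalGC.fold p) = p := by
      rw [hfold]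
      exact LocalGC.rearr_of_antitone (fun j => (hp j).1) hanti
    have hmean : LocalGC.mean (LocalGC.bernoulliProduct p) = p :=
      LocalGC.mean_bernoulliProduct fun j => ⟨(hp j).1, by linarith [(hp j).2]⟩
    -- `LGC` speaks of the Bernoulli product with mean `p`; finiteness of `T` is obtained there and
    -- depends on the mean alone.
    have hT : LocalGC.T p < ⊤ := by
      rw [← hmean]
      refine LocalGC.T_mean_lt_top _ ?_ ?_ hΔ
      · change ∀ j, LocalGC.mean (LocalGC.bernoulliProduct p) j ∈ _
        rwa [hmean]
      · change Antitone (LocalGC.mean (LocalGC.bernoulliProduct p))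
        rwa [hmean]
    have := LocalGC.limsup_le_of_T_lt_top (Measure.infinitePi ν)
      (by rwa [← hpdef, hfold]) (by rwa [← hpdef, hrearr])
    rwa [← hpdef, hrearr] at this
  · intro μ _ hT
    by_cases ht : Tendsto (LocalGC.fold (LocalGC.mean μ)) atTop (𝓝 0)
    · rw [LocalGC.measT, if_pos ht] at hT
      rw [LocalGC.measS, if_pos ht]
      exact LocalGC.limsup_le_of_T_lt_top μ ht hT
    · rw [LocalGC.measT, if_neg ht] at hT
      exact absurd hT (lt_irrefl _)
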